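/- A $4$-graph $G$ consists of a finite non-empty vertex set $V(G)$ and a set $E(G)$ of $4$-element subsets of $V(G)$. Its Lagrangian is $$\lambda(G)=\max\Big\{\sum_{e\in E(G)}\ \prod_{i\in e}x_i \;:\; x_i\ge 0 \text{ for all } i\in V(G),\ \sum_{i\in V(G)}x_i=1\Big\}.$$ For a $4$-graph $F$, call $G$ $F$-free if it has no subgraph isomorphic to $F$, and let the Lagrangian density of $F$ be $$\pi_\lambda(F)=\sup\{4!\,\lambda(G): G \text{ is an } F\text{-free } 4\text{-graph}\}.$$ Let $M_2^4$ be the $4$-graph on $8$ vertices consisting of two disjoint edges, and for $n\ge 1$ let the star $\mathcal S_n$ be the $4$-graph on $\{1,\dots,n\}$ whose edges are all $4$-element subsets containing the vertex $1$. Then every $\mathcal S_n$ is $M_2^4$-free, the limit $\lambda(\mathcal S):=\lim_{n\to\infty}\lambda(\mathcal S_n)$ exists, and $$\pi_\lambda(M_2^4)=4!\,\lambda(\mathcal S)=\frac{27}{64}.$$ -/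

import Mathlib

open scoped Nat

/-- An `r`-uniform hypergraph (`r`-graph) on the vertex type `V`: a finite family of `r`-subsets. -/
structure RGraph (r : ℕ) (V : Type*) where
  /-- The edge set. -/
  edges : Finset (Finset V)
  uniform : ∀ e ∈ edges, e.card = r

namespace RGraph

variable {r : ℕ} {V W : Type*}

/-- `G` is `F`-free: no injection of the vertices of `F` into those of `G` maps every edge
of `F` to an edge of `G`, that is, `G` has no subgraph isomorphic to `F`. -/
def Free (F : RGraph r W) (G : RGraph r V) : Prop :=
  ¬ ∃ f : W ↪ V, ∀ e ∈ F.edges, e.map f ∈ G.edges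

/-- The Lagrangian function `λ(G, x) = ∑_{e ∈ E(G)} ∏_{i ∈ e} x_i`. -/
def lagrangianFun (G : RGraph r V) (x : V → ℝ) : ℝ :=
  ∑ e ∈ G.edges, ∏ i ∈ e, x i

/-- The Lagrangian `λ(G)`: the maximum of `λ(G, x)` over all nonnegative weightings `x` of total
weight `1`. By `isGreatest_lagrangian` below the supremum is a maximum. -/
noncomputable def lagrangian [Fintype V] (G : RGraph r V) : ℝ :=
  sSup (G.lagrangianFun '' stdSimplex ℝ V)

theorem isGreatest_lagrangian [Fintype V] [Nonempty V] (G : RGraph r V) :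
    IsGreatest (G.lagrangianFun '' stdSimplex ℝ V) G.lagrangian := by
  classical
  have hc : Continuous G.lagrangianFun := by
    unfold lagrangianFun
    fun_prop
  have hne : (stdSimplex ℝ V).Nonempty :=
    ⟨_, single_mem_stdSimplex ℝ (Classical.arbitrary V)⟩
  exact ((isCompact_stdSimplex ℝ V).image hc).isGreatest_sSup (hne.image _)

/-- The Lagrangian density `π_λ(F) = sup {r! λ(G) : G is an F-free r-graph}`; up to isomorphism
the finite `r`-graphs with at least one vertex are those on `Fin n`, `n ≥ 1`. -/
noncomputable def lagrangianDensity (F : RGraph r W) : ℝ :=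
  sSup {y : ℝ | ∃ n : ℕ, 1 ≤ n ∧ ∃ G : RGraph r (Fin n), Free F G ∧ y = (r ! : ℝ) * G.lagrangian}

/-- The `r`-uniform `t`-matching `M_t^r`: the `t` pairwise disjoint edges `{i} × Fin r`. -/
def matching (r t : ℕ) : RGraph r (Fin t × Fin r) where
  edges := Finset.univ.image fun i : Fin t => ({i} : Finset (Fin t)) ×ˢ Finset.univ
  uniform := by
    intro e he
    obtain ⟨i, -, rfl⟩ := Finset.mem_image.mp he
    simp

/-- The star: the edges are all `r`-subsets of `V` containing the fixed vertex `v`. -/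
def star (r : ℕ) [Fintype V] [DecidableEq V] (v : V) : RGraph r V where
  edges := {e ∈ Finset.powersetCard r Finset.univ | v ∈ e}
  uniform := by
    intro e he
    exact (Finset.mem_powersetCard.mp (Finset.mem_filter.mp he).1).2

end RGraph

/-!
Two edges of size four span a copy of `matching 4 2` exactly when they are disjoint, so the theorem
says that an intersecting family `H` of `4`-sets has Lagrangian at most `9 / 512`, the supremum of
`x₀ (1 - x₀)³ / 6`, which stars attain in the limit with weight `1/4` at the centre and the rest
spread evenly over many leaves (`le_lagrangian_star`, `tendsto_choose_three_mul`).

For the upper bound, vertices are natural numbers. Take a family and a weighting `x` maximizing the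
Lagrangian function over all intersecting families on `{0, …, N - 1}`. Sorting makes `x` decreasing,
and shifting, which keeps the family intersecting and does not lower its weight, makes the family
shifted (`exists_isOptimal_isShifted`). At this optimum with value `Λ`, the link of every vertex
of positive weight has weight at least `4 Λ` (`IsOptimal.four_mul_weight_le`), so it is enough to
find one vertex of positive weight whose link has weight at most `9 / 128`.

If all members contain `0`, then `Λ ≤ x₀ (1 - x₀)³ / 6`. Otherwise `{1, 2, 3, 4}` is a member, and
the members containing `0` must meet it.
* If `x₀ ≥ 1/6`, this makes the link of `0` light (`linkWeight_zero_le`).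
* If `x₀ ≤ 1/6` and the last vertex `v` of positive weight is at least `7`, then the link of `v` is
  light: shiftedness excludes `{1, 3, 5, 7}`, which leaves few sets with largest element `v`
  (`link_last_shapes`, `linkWeight_last_le`).
* If only the vertices `0, …, 6` have positive weight, then `x₀ ≥ 1/7`, and all triples from the six
  other vertices together weigh little enough (`linkWeight_zero_le_of_seven`).
-/

namespace IntersectingFamily

open Finset

/-! ### Optimal pairs of an intersecting family and a weighting -/

/-- The weight `∑_{e ∈ H} ∏_{i ∈ e} x_i` of a finite family `H` of finite sets of naturals. -/
def weight (x : ℕ → ℝ) (H : Finset (Finset ℕ)) : ℝ := ∑ e ∈ H, ∏ i ∈ e, x i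

/-- The partial derivative of `weight x H` in the variable `x v`: the weight of the link of `v`. -/
def linkWeight (x : ℕ → ℝ) (H : Finset (Finset ℕ)) (v : ℕ) : ℝ :=
  ∑ e ∈ H with v ∈ e, ∏ i ∈ e.erase v, x i

/-- Nonnegative weightings of `ℕ` of total weight `1` that vanish outside `{0, …, N - 1}`. -/
def weightings (N : ℕ) : Set (ℕ → ℝ) :=
  {x | (∀ i, 0 ≤ x i) ∧ (∀ i, N ≤ i → x i = 0) ∧ ∑ i ∈ range N, x i = 1}

/-- The intersecting families of `4`-subsets of `{0, …, N - 1}`. -/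
def families (N : ℕ) : Set (Finset (Finset ℕ)) :=
  {H | H ⊆ powersetCard 4 (range N) ∧ (H : Set (Finset ℕ)).Intersecting}

lemma le_one_of_mem_weightings {N : ℕ} {x : ℕ → ℝ} (hx : x ∈ weightings N) (i : ℕ) : x i ≤ 1 := by
  obtain ⟨h0, hN, h1⟩ := hx
  by_cases hi : i < N
  · rw [← h1]
    exact single_le_sum (fun j _ => h0 j) (mem_range.2 hi)
  · rw [hN i (not_lt.1 hi)]
    exact zero_le_one

lemma isCompact_weightings (N : ℕ) : IsCompact (weightings N) := by
  refine (isCompact_univ_pi (fun _ : ℕ => isCompact_Icc (a := (0 : ℝ)) (b := 1))).of_isClosed_subset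
    ?_ (fun x hx i _ => ⟨hx.1 i, le_one_of_mem_weightings hx i⟩)
  have e : weightings N = (⋂ i, {x : ℕ → ℝ | 0 ≤ x i}) ∩ ((⋂ i, ⋂ (_ : N ≤ i), {x | x i = 0}) ∩
      {x | ∑ i ∈ range N, x i = 1}) := by
    ext x
    simp [weightings]
  rw [e]
  refine (isClosed_iInter fun i => isClosed_le continuous_const (continuous_apply i)).inter
    ((isClosed_iInter fun i => isClosed_iInter fun _ =>
      isClosed_eq (continuous_apply i) continuous_const).inter
      (isClosed_eq (by fun_prop) continuous_const))

lemma continuous_weight (H : Finset (Finset ℕ)) : Continuous fun x => weight x H := by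
  unfold weight
  fun_prop

/-- A pair `(H, x)` maximizing the weight among intersecting families and weightings. -/
def IsOptimal (N : ℕ) (H : Finset (Finset ℕ)) (x : ℕ → ℝ) : Prop :=
  H ∈ families N ∧ x ∈ weightings N ∧
    ∀ H' ∈ families N, ∀ x' ∈ weightings N, weight x' H' ≤ weight x H

lemma exists_isOptimal {N : ℕ} (hN : 0 < N) : ∃ H x, IsOptimal N H x := by
  have hne : (weightings N).Nonempty := by
    refine ⟨Pi.single 0 1, fun i => ?_, fun i hi => ?_, ?_⟩
    · by_cases h : i = 0 <;> simp [h]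
    · exact Pi.single_eq_of_ne (by omega) _
    · simp [Pi.single_apply, hN.ne']
  choose m hm hmax using fun H : Finset (Finset ℕ) =>
    (isCompact_weightings N).exists_isMaxOn hne (continuous_weight H).continuousOn
  classical
  obtain ⟨H, hH, hH'⟩ := exists_max_image
    ((powersetCard 4 (range N)).powerset.filter (fun H => H ∈ families N))
    (fun H => weight (m H) H) ⟨∅, by simp [families, Set.Intersecting]⟩
  refine ⟨H, m H, (mem_filter.1 hH).2, hm H, fun H' h' x' hx' => ?_⟩
  exact (hmax H' hx').trans (hH' H' (mem_filter.2 ⟨mem_powerset.2 h'.1, h'⟩))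

lemma exists_sorting {N : ℕ} {x : ℕ → ℝ} (hx : x ∈ weightings N) :
    ∃ σ : Equiv.Perm ℕ, (∀ i, σ i < N ↔ i < N) ∧ Antitone (x ∘ σ) := by
  obtain ⟨h0, hN, -⟩ := hx
  let f : Fin N → ℝ := fun i => - x i
  let τ := Tuple.sort f
  let σ : Equiv.Perm ℕ := τ.extendDomain (Fin.equivSubtype (n := N))
  have h1 : ∀ i (hi : i < N), σ i = τ ⟨i, hi⟩ := fun i hi => by
    have := Equiv.Perm.extendDomain_apply_image τ (Fin.equivSubtype (n := N)) ⟨i, hi⟩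
    simpa using this
  have h2 : ∀ i, ¬ i < N → σ i = i := fun i hi =>
    Equiv.Perm.extendDomain_apply_not_subtype τ _ hi
  refine ⟨σ, fun i => ?_, fun i j hij => ?_⟩
  · by_cases hi : i < N
    · simp [h1 i hi, hi]
    · simp [h2 i hi]
  · by_cases hj : j < N
    · have hi := hij.trans_lt hj
      have := Tuple.monotone_sort f (show (⟨i, hi⟩ : Fin N) ≤ ⟨j, hj⟩ from hij)
      simp only [Function.comp, h1 i hi, h1 j hj]
      simpa [f] using this
    · simp only [Function.comp, h2 j hj, hN j (not_lt.1 hj)]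
      exact h0 _

lemma weight_map (σ : Equiv.Perm ℕ) (x : ℕ → ℝ) (H : Finset (Finset ℕ)) :
    weight x (H.map (mapEmbedding σ.toEmbedding).toEmbedding) = weight (x ∘ σ) H := by
  simp [weight, mapEmbedding_apply]

lemma map_mem_families {N : ℕ} {H : Finset (Finset ℕ)} (hH : H ∈ families N) {σ : Equiv.Perm ℕ}
    (hσ : ∀ i, σ i < N ↔ i < N) :
    H.map (mapEmbedding σ.toEmbedding).toEmbedding ∈ families N := by
  refine ⟨fun e he => ?_, fun a ha b hb => ?_⟩
  · obtain ⟨e, he', rfl⟩ := mem_map.1 he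
    have h := mem_powersetCard.1 (hH.1 he')
    refine mem_powersetCard.2 ⟨fun i hi => ?_, ?_⟩
    · obtain ⟨i, hi', rfl⟩ := mem_map.1 (show i ∈ e.map σ.toEmbedding from hi)
      simpa [hσ] using h.1 hi'
    · simpa [mapEmbedding_apply] using h.2
  · obtain ⟨a, ha', rfl⟩ := mem_map.1 (mem_coe.1 ha)
    obtain ⟨b, hb', rfl⟩ := mem_map.1 (mem_coe.1 hb)
    have := hH.2 (mem_coe.2 ha') (mem_coe.2 hb')
    simpa [mapEmbedding_apply] using this

lemma exists_isOptimal_antitone {N : ℕ} (hN : 0 < N) :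
    ∃ H x, IsOptimal N H x ∧ Antitone x := by
  obtain ⟨H, x, hH, hx, hmax⟩ := exists_isOptimal hN
  obtain ⟨σ, hσ, hanti⟩ := exists_sorting hx
  have hσ' : ∀ i, σ.symm i < N ↔ i < N := fun i => by rw [← hσ, Equiv.apply_symm_apply]
  refine ⟨_, x ∘ σ, ⟨map_mem_families hH hσ', ⟨fun i => hx.1 _, fun i hi => hx.2.1 _ ?_, ?_⟩,
    fun H' h' x' hx' => ?_⟩, hanti⟩
  · rw [← not_lt, hσ]
    exact not_lt.2 hi
  · rw [← hx.2.2]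
    exact sum_equiv σ (by simp [hσ]) (by simp)
  · rw [weight_map]
    have : (x ∘ σ) ∘ σ.symm = x := by
      ext i
      simp
    rw [this]
    exact hmax H' h' x' hx'

/-! ### Shifting -/

/-- The replacement of `j` by `i` in `e`. -/
def moveElem (i j : ℕ) (e : Finset ℕ) : Finset ℕ := insert i (e.erase j)

open Classical in
/-- The effect of the `(i, j)`-shift of the family `H` on its member `e`: replace `j` by `i` unless
this is impossible or the result already belongs to `H`. -/
noncomputable def shiftMember (H : Finset (Finset ℕ)) (i j : ℕ) (e : Finset ℕ) : Finset ℕ :=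
  if j ∈ e ∧ i ∉ e ∧ moveElem i j e ∉ H then moveElem i j e else e

lemma moveElem_injOn {i j : ℕ} {a b : Finset ℕ} (ha : j ∈ a) (ha' : i ∉ a) (hb : j ∈ b)
    (hb' : i ∉ b) (h : moveElem i j a = moveElem i j b) : a = b := by
  have h2 : (moveElem i j a).erase i = (moveElem i j b).erase i := by rw [h]
  rw [moveElem, moveElem, erase_insert (by simp [ha']), erase_insert (by simp [hb'])] at h2
  rw [← insert_erase ha, h2, insert_erase hb]

lemma shiftMember_injOn (H : Finset (Finset ℕ)) (i j : ℕ) :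
    Set.InjOn (shiftMember H i j) (H : Set (Finset ℕ)) := by
  intro a ha b hb h
  rw [mem_coe] at ha hb
  unfold shiftMember at h
  split_ifs at h with h1 h2 h2
  · exact moveElem_injOn h1.1 h1.2.1 h2.1 h2.2.1 h
  · exact absurd (h ▸ hb) h1.2.2
  · exact absurd (h ▸ ha) h2.2.2
  · exact h

lemma image_shiftMember_mem_families {N : ℕ} {H : Finset (Finset ℕ)} (hH : H ∈ families N)
    {i j : ℕ} (hij : i < j) : H.image (shiftMember H i j) ∈ families N := by
  have key : ∀ a ∈ H, ∀ b ∈ H, (j ∈ a ∧ i ∉ a ∧ moveElem i j a ∉ H) →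
      ¬ (j ∈ b ∧ i ∉ b ∧ moveElem i j b ∉ H) → ¬ Disjoint (moveElem i j a) b := by
    intro a ha b hb h1 h2
    rw [not_disjoint_iff]
    by_cases hib : i ∈ b
    · exact ⟨i, mem_insert_self _ _, hib⟩
    by_cases hjb : j ∈ b
    · -- here `b` was kept because its replacement lies in `H` and hence meets `a`
      have h3 : moveElem i j b ∈ H := by tauto
      obtain ⟨k, hk, hk'⟩ := not_disjoint_iff.1 (hH.2 (mem_coe.2 ha) (mem_coe.2 h3))
      rcases mem_insert.1 hk' with rfl | hk'
      · exact absurd hk h1.2.1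
      · exact ⟨k, mem_insert_of_mem (mem_erase.2 ⟨ne_of_mem_erase hk', hk⟩), mem_of_mem_erase hk'⟩
    · obtain ⟨k, hk, hk'⟩ := not_disjoint_iff.1 (hH.2 (mem_coe.2 ha) (mem_coe.2 hb))
      exact ⟨k, mem_insert_of_mem (mem_erase.2 ⟨fun h => hjb (h ▸ hk'), hk⟩), hk'⟩
  refine ⟨fun e he => ?_, fun a ha b hb => ?_⟩
  · obtain ⟨e, he', rfl⟩ := mem_image.1 he
    have h := mem_powersetCard.1 (hH.1 he')
    unfold shiftMember
    split_ifs with h1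
    · refine mem_powersetCard.2 ⟨fun k hk => ?_, ?_⟩
      · rcases mem_insert.1 hk with rfl | hk
        · exact mem_range.2 (hij.trans (mem_range.1 (h.1 h1.1)))
        · exact h.1 (mem_of_mem_erase hk)
      · rw [moveElem, card_insert_of_notMem (by simp [h1.2.1]), card_erase_of_mem h1.1, h.2]
    · exact hH.1 he'
  · obtain ⟨a, ha', rfl⟩ := mem_image.1 (mem_coe.1 ha)
    obtain ⟨b, hb', rfl⟩ := mem_image.1 (mem_coe.1 hb)
    unfold shiftMember
    split_ifs with h1 h2 h2
    · exact not_disjoint_iff.2 ⟨i, mem_insert_self _ _, mem_insert_self _ _⟩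
    · exact key a ha' b hb' h1 h2
    · exact fun h => key b hb' a ha' h2 h1 h.symm
    · exact hH.2 (mem_coe.2 ha') (mem_coe.2 hb')

/-- A family is shifted if replacing an element of a member by a smaller non-element always gives
a member. -/
def IsShifted (H : Finset (Finset ℕ)) : Prop :=
  ∀ e ∈ H, ∀ i j, i < j → j ∈ e → i ∉ e → moveElem i j e ∈ H

/-- Among the families of maximal weight for a fixed decreasing `x`, one with the least sum of
elements of members is shifted, because a shift never lowers the weight. -/
lemma exists_isOptimal_isShifted {N : ℕ} (hN : 0 < N) :
    ∃ H x, IsOptimal N H x ∧ Antitone x ∧ IsShifted H := by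
  obtain ⟨H₀, x, h₀, hx⟩ := exists_isOptimal_antitone hN
  classical
  obtain ⟨H, hH, hmin⟩ := exists_min_image
    ((powersetCard 4 (range N)).powerset.filter (fun H => IsOptimal N H x))
    (fun H => ∑ e ∈ H, ∑ i ∈ e, i)
    ⟨H₀, mem_filter.2 ⟨mem_powerset.2 h₀.1.1, h₀⟩⟩
  replace hH := (mem_filter.1 hH).2
  refine ⟨H, x, hH, hx, fun e he i j hij hj hi => ?_⟩
  by_contra hne
  have hfam := image_shiftMember_mem_families hH.1 hij
  have hw : weight x H ≤ weight x (H.image (shiftMember H i j)) := by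
    unfold weight
    rw [sum_image (shiftMember_injOn H i j)]
    refine sum_le_sum fun a _ => ?_
    unfold shiftMember
    split_ifs with h1
    · rw [moveElem, prod_insert (by simp [h1.2.1]), ← mul_prod_erase a x h1.1]
      exact mul_le_mul_of_nonneg_right (hx hij.le) (prod_nonneg fun k _ => hH.2.1.1 k)
    · exact le_rfl
  have hopt : IsOptimal N (H.image (shiftMember H i j)) x :=
    ⟨hfam, hH.2.1, fun H' h' x' hx' => (hH.2.2 H' h' x' hx').trans hw⟩
  have hle := hmin _ (mem_filter.2 ⟨mem_powerset.2 hfam.1, hopt⟩)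
  rw [sum_image (shiftMember_injOn H i j)] at hle
  refine absurd hle (not_le.2 (sum_lt_sum (fun a _ => ?_) ⟨e, he, ?_⟩))
  · unfold shiftMember
    split_ifs with h1
    · rw [moveElem, sum_insert (by simp [h1.2.1]), ← add_sum_erase a (fun k => k) h1.1]
      omega
    · exact le_rfl
  · rw [shiftMember, if_pos ⟨hj, hi, hne⟩, moveElem, sum_insert (by simp [hi]),
      ← add_sum_erase e (fun k => k) hj]
    omega

/-- A member of a shifted family stays one when its elements, listed in increasing order, are
lowered. -/
lemma IsShifted.mem_of_le {H : Finset (Finset ℕ)} (hH : IsShifted H) {p q r s p' q' r' s' : ℕ}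
    (h : ({p, q, r, s} : Finset ℕ) ∈ H) (hpq : p < q) (hqr : q < r) (hrs : r < s)
    (hpq' : p' < q') (hqr' : q' < r') (hrs' : r' < s') (hp : p' ≤ p) (hq : q' ≤ q) (hr : r' ≤ r)
    (hs : s' ≤ s) : ({p', q', r', s'} : Finset ℕ) ∈ H := by
  have h1 : ({p', q, r, s} : Finset ℕ) ∈ H := by
    rcases hp.eq_or_lt with rfl | hp
    · exact h
    · convert hH _ h p' p hp (by simp) (by simp; omega) using 1
      ext k; simp [moveElem]; omega
  have h2 : ({p', q', r, s} : Finset ℕ) ∈ H := by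
    rcases hq.eq_or_lt with rfl | hq
    · exact h1
    · convert hH _ h1 q' q hq (by simp) (by simp; omega) using 1
      ext k; simp [moveElem]; omega
  have h3 : ({p', q', r', s} : Finset ℕ) ∈ H := by
    rcases hr.eq_or_lt with rfl | hr
    · exact h2
    · convert hH _ h2 r' r hr (by simp) (by simp; omega) using 1
      ext k; simp [moveElem]; omega
  rcases hs.eq_or_lt with rfl | hs
  · exact h3
  · convert hH _ h3 s' s hs (by simp) (by simp; omega) using 1
    ext k; simp [moveElem]; omega

lemma exists_eq_of_card_eq_four {e : Finset ℕ} (h : e.card = 4) :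
    ∃ p q r s, p < q ∧ q < r ∧ r < s ∧ e = {p, q, r, s} := by
  let f := e.orderEmbOfFin h
  refine ⟨f 0, f 1, f 2, f 3, f.strictMono (by decide), f.strictMono (by decide),
    f.strictMono (by decide), ?_⟩
  ext k
  rw [← mem_coe, ← range_orderEmbOfFin e h, Set.mem_range, Fin.exists_fin_succ]
  simp only [Fin.exists_fin_succ, mem_insert, mem_singleton, f, eq_comm (a := k)]
  simp

/-! ### Optimality conditions -/

lemma weight_smul {N : ℕ} {H : Finset (Finset ℕ)} (hH : H ∈ families N) (c : ℝ) (x : ℕ → ℝ) :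
    weight (fun i => c * x i) H = c ^ 4 * weight x H := by
  unfold weight
  rw [mul_sum]
  refine sum_congr rfl fun e he => ?_
  rw [prod_mul_distrib, prod_const, (mem_powersetCard.1 (hH.1 he)).2]

lemma weight_update (x : ℕ → ℝ) (H : Finset (Finset ℕ)) (v : ℕ) (ε : ℝ) :
    weight (Function.update x v (x v - ε)) H = weight x H - ε * linkWeight x H v := by
  unfold weight linkWeight
  rw [sum_filter, mul_sum, ← sum_sub_distrib]
  refine sum_congr rfl fun e _ => ?_
  split_ifs with hv
  · rw [← mul_prod_erase e _ hv, ← mul_prod_erase e x hv, Function.update_self,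
      prod_congr rfl fun i hi => Function.update_of_ne (ne_of_mem_erase hi) _ x]
    ring
  · rw [mul_zero, sub_zero]
    exact prod_congr rfl fun i hi => Function.update_of_ne (ne_of_mem_of_not_mem hi hv) _ x

/-- At an optimum, the derivative in the direction of a vertex of positive weight is at least
four times the maximum: lower the weight of that vertex by `ε` and rescale to total weight `1`. -/
lemma IsOptimal.four_mul_weight_le {N : ℕ} {H : Finset (Finset ℕ)} {x : ℕ → ℝ}
    (h : IsOptimal N H x) {v : ℕ} (hv : 0 < x v) : 4 * weight x H ≤ linkWeight x H v := by
  obtain ⟨hH, ⟨h0, hN, h1⟩, hmax⟩ := h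
  have hw : 0 ≤ weight x H := sum_nonneg fun e _ => prod_nonneg fun i _ => h0 i
  have hvN : v < N := by
    by_contra hlt
    exact hv.ne' (hN v (not_lt.1 hlt))
  have key : ∀ ε, 0 < ε → ε ≤ x v → ε < 1 →
      4 * weight x H ≤ linkWeight x H v + 6 * weight x H * ε := by
    intro ε hε hεv hε1
    set y := Function.update x v (x v - ε) with hy
    have hy1 : ∑ i ∈ range N, y i = 1 - ε := by
      rw [hy, sum_update_of_mem (mem_range.2 hvN), ← h1,
        ← sum_sdiff (singleton_subset_iff.2 (mem_range.2 hvN)), sum_singleton]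
      ring
    have hpos : 0 < 1 - ε := by linarith
    have hymem : (fun i => (1 - ε)⁻¹ * y i) ∈ weightings N := by
      refine ⟨fun i => mul_nonneg (inv_nonneg.2 hpos.le) ?_, fun i hi => ?_, ?_⟩
      · rcases eq_or_ne i v with rfl | hi
        · simpa [hy] using hεv
        · simpa [hy, hi] using h0 i
      · have : i ≠ v := by omega
        simp [hy, this, hN i hi]
      · rw [← mul_sum, hy1, inv_mul_cancel₀ hpos.ne']
    have h2 := hmax H hH _ hymem
    rw [weight_smul hH, hy, weight_update, inv_pow, inv_mul_le_iff₀ (by positivity)] at h2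
    have h3 : (1 - ε) ^ 4 ≤ 1 - 4 * ε + 6 * ε ^ 2 := by
      nlinarith [pow_pos hε 3]
    have h4 := h2.trans (mul_le_mul_of_nonneg_right h3 hw)
    refine le_of_mul_le_mul_left ?_ hε
    linarith
  by_contra! hlt
  set d := 4 * weight x H - linkWeight x H v with hd
  have hdpos : 0 < d := by linarith
  have hc : 0 < 6 * weight x H + 1 := by linarith
  let ε := min (min (x v) (1 / 2)) (d / (6 * weight x H + 1))
  have hε : 0 < ε := lt_min (lt_min hv (by norm_num)) (by positivity)
  have h5 := key ε hε ((min_le_left _ _).trans (min_le_left _ _))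
    (((min_le_left _ _).trans (min_le_right _ _)).trans_lt (by norm_num))
  have h6 : ε * (6 * weight x H + 1) ≤ d := (le_div_iff₀ hc).1 (min_le_right _ _)
  linarith

/-! ### Weights of links -/

lemma weight_mono {x : ℕ → ℝ} (hx : ∀ i, 0 ≤ x i) {L L' : Finset (Finset ℕ)} (h : L ⊆ L') :
    weight x L ≤ weight x L' :=
  sum_le_sum_of_subset_of_nonneg h fun _ _ _ => prod_nonneg fun i _ => hx i

lemma weight_union_le {x : ℕ → ℝ} (hx : ∀ i, 0 ≤ x i) (L L' : Finset (Finset ℕ)) :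
    weight x (L ∪ L') ≤ weight x L + weight x L' := by
  unfold weight
  rw [← sum_union_inter]
  exact le_add_of_nonneg_right (sum_nonneg fun _ _ => prod_nonneg fun i _ => hx i)

lemma weight_image_le {ι : Type*} [DecidableEq ι] {x : ℕ → ℝ} (hx : ∀ i, 0 ≤ x i)
    (s : Finset ι) (g : ι → Finset ℕ) :
    weight x (s.image g) ≤ ∑ a ∈ s, ∏ i ∈ g a, x i := by
  unfold weight
  induction s using Finset.induction_on with
  | empty => simp
  | insert a s ha ih =>
    rw [image_insert, sum_insert ha]
    by_cases hmem : g a ∈ s.image g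
    · rw [insert_eq_of_mem hmem]
      exact ih.trans (le_add_of_nonneg_left (prod_nonneg fun i _ => hx i))
    · rw [sum_insert hmem]
      gcongr

/-- Only members of the link on which `x` is positive contribute to its weight. -/
lemma linkWeight_le {x : ℕ → ℝ} (hx : ∀ i, 0 ≤ x i) {H L : Finset (Finset ℕ)} {v : ℕ}
    (h : ∀ e ∈ H, v ∈ e → (∀ i ∈ e.erase v, 0 < x i) → e.erase v ∈ L) :
    linkWeight x H v ≤ weight x L := by
  classical
  have h1 : linkWeight x H v = ∑ e ∈ H with v ∈ e ∧ ∀ i ∈ e.erase v, 0 < x i,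
      ∏ i ∈ e.erase v, x i := by
    unfold linkWeight
    rw [← filter_filter]
    refine (sum_filter_of_ne fun e _ hne i hi => (hx i).lt_of_ne' fun h0 => ?_).symm
    exact hne (prod_eq_zero hi h0)
  have h2 : Set.InjOn (fun e : Finset ℕ => e.erase v)
      ({e ∈ H | v ∈ e ∧ ∀ i ∈ e.erase v, 0 < x i} : Finset (Finset ℕ)) := by
    intro a ha b hb hab
    have ha' := (mem_filter.1 (mem_coe.1 ha)).2.1
    have hb' := (mem_filter.1 (mem_coe.1 hb)).2.1
    rw [← insert_erase ha', ← insert_erase hb']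
    exact congrArg _ hab
  refine (h1.trans (sum_image (f := fun T : Finset ℕ => ∏ i ∈ T, x i) h2).symm).trans_le
    (weight_mono hx fun T hT => ?_)
  obtain ⟨e, he, rfl⟩ := mem_image.1 hT
  obtain ⟨he, hv, hpos⟩ := mem_filter.1 he
  exact h e he hv hpos

/-! ### Elementary symmetric sums -/

/-- The `k`-th elementary symmetric polynomial of the weights `x i`, `i ∈ A`. -/
def esum (x : ℕ → ℝ) (k : ℕ) (A : Finset ℕ) : ℝ := weight x (powersetCard k A)

lemma esum_one (x : ℕ → ℝ) (A : Finset ℕ) : esum x 1 A = ∑ i ∈ A, x i := by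
  simp [esum, weight, powersetCard_one]

lemma esum_insert (x : ℕ → ℝ) (k : ℕ) {a : ℕ} {A : Finset ℕ} (ha : a ∉ A) :
    esum x (k + 1) (insert a A) = esum x (k + 1) A + x a * esum x k A := by
  unfold esum weight
  rw [powersetCard_succ_insert ha, sum_union, sum_image, mul_sum]
  · congr 1
    refine sum_congr rfl fun e he => prod_insert fun h => ha ((mem_powersetCard.1 he).1 h)
  · intro e he e' he' h
    have h1 : a ∉ e := fun h => ha ((mem_powersetCard.1 (mem_coe.1 he)).1 h)
    have h2 : a ∉ e' := fun h => ha ((mem_powersetCard.1 (mem_coe.1 he')).1 h)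
    rw [← erase_insert h1, ← erase_insert h2]
    exact congrArg (fun s => s.erase a) h
  · rw [disjoint_left]
    intro e he he'
    obtain ⟨e', -, rfl⟩ := mem_image.1 he'
    exact ha ((mem_powersetCard.1 he).1 (mem_insert_self _ _))

lemma esum_Ico (x : ℕ → ℝ) (k : ℕ) {a b : ℕ} (h : a < b) :
    esum x (k + 1) (Ico a b) = esum x (k + 1) (Ico (a + 1) b) + x a * esum x k (Ico (a + 1) b) := by
  rw [← esum_insert x k (by simp), insert_Ico_add_one_left_eq_Ico h]

lemma two_mul_esum_two_le (x : ℕ → ℝ) (A : Finset ℕ) : 2 * esum x 2 A ≤ (∑ i ∈ A, x i) ^ 2 := by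
  induction A using Finset.induction_on with
  | empty =>
    rw [esum, powersetCard_eq_empty.2 (by simp)]
    simp [weight]
  | insert a A ha ih =>
    rw [esum_insert x 1 ha, sum_insert ha, esum_one]
    nlinarith [sq_nonneg (x a)]

lemma six_mul_esum_three_le {x : ℕ → ℝ} (hx : ∀ i, 0 ≤ x i) (A : Finset ℕ) :
    6 * esum x 3 A ≤ (∑ i ∈ A, x i) ^ 3 := by
  induction A using Finset.induction_on with
  | empty =>
    rw [esum, powersetCard_eq_empty.2 (by simp)]
    simp [weight]
  | insert a A ha ih =>
    rw [esum_insert x 2 ha, sum_insert ha]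
    have h1 := mul_le_mul_of_nonneg_left (two_mul_esum_two_le x A) (hx a)
    have h2 : 0 ≤ ∑ i ∈ A, x i := sum_nonneg fun i _ => hx i
    nlinarith [mul_nonneg h2 (sq_nonneg (x a)), pow_nonneg (hx a) 3]

/-! ### Polynomial inequalities -/

lemma mul_one_sub_pow_three_le (t : ℝ) : t * (1 - t) ^ 3 ≤ 27 / 256 := by
  nlinarith [mul_nonneg (sq_nonneg (1 - t - 3 / 4)) (sq_nonneg (1 - t + 1 / 4)),
    sq_nonneg (1 - t - 3 / 4)]

lemma esymm_two_four_le (p q r s : ℝ) :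
    p * q + p * r + p * s + q * r + q * s + r * s ≤ 3 / 8 * (p + q + r + s) ^ 2 := by
  nlinarith [sq_nonneg (p - q), sq_nonneg (p - r), sq_nonneg (p - s), sq_nonneg (q - r),
    sq_nonneg (q - s), sq_nonneg (r - s)]

lemma esymm_three_four_le {p q r s : ℝ} (hp : 0 ≤ p) (hq : 0 ≤ q) (hr : 0 ≤ r) (hs : 0 ≤ s) :
    p * q * r + p * q * s + p * r * s + q * r * s ≤ (p + q + r + s) ^ 3 / 16 := by
  nlinarith [mul_nonneg (add_nonneg hr hs) (sq_nonneg (p - q)),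
    mul_nonneg (add_nonneg hp hq) (sq_nonneg (r - s)),
    mul_nonneg (add_nonneg (add_nonneg hp hq) (add_nonneg hr hs)) (sq_nonneg (p + q - r - s))]

/-- The sum of the products of three weights with at least one factor among four fixed vertices of
total weight `f`, when the other vertices have total weight `m`. The square in the proof vanishes
near the maximum at `f = 1.1 m`. -/
lemma cubic_meeting_le {f m : ℝ} (hf : 0 ≤ f) (hm : 0 ≤ m) (h : f + m ≤ 5 / 6) :
    f * (m ^ 2 / 2) + 3 / 8 * f ^ 2 * m + f ^ 3 / 16 ≤ 9 / 128 := by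
  have h1 : f * (m ^ 2 / 2) + 3 / 8 * f ^ 2 * m + f ^ 3 / 16 ≤ 243 / 2000 * (f + m) ^ 3 := by
    nlinarith [mul_nonneg hf (sq_nonneg (f - 11 / 10 * m)),
      mul_nonneg hm (sq_nonneg (f - 11 / 10 * m)), mul_nonneg (mul_nonneg hf hf) hm,
      mul_nonneg (mul_nonneg hf hm) hm, pow_nonneg hm 3, pow_nonneg hf 3]
  have h2 : (f + m) ^ 3 ≤ (5 / 6) ^ 3 := by gcongr
  linarith

/-- The analogue of `cubic_meeting_le` when there are just two other vertices. -/
lemma cubic_six_vertices_le {f m : ℝ} (hf : 0 ≤ f) (hm : 0 ≤ m) (h : f + m ≤ 6 / 7) :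
    f * (m ^ 2 / 4) + 3 / 8 * f ^ 2 * m + f ^ 3 / 16 ≤ 9 / 128 := by
  have h1 : f * (m ^ 2 / 4) + 3 / 8 * f ^ 2 * m + f ^ 3 / 16 ≤ 5 / 54 * (f + m) ^ 3 := by
    nlinarith [mul_nonneg hf (sq_nonneg (f - 2 * m)), mul_nonneg hm (sq_nonneg (f - 2 * m))]
  have h2 : (f + m) ^ 3 ≤ (6 / 7) ^ 3 := by gcongr
  linarith

/-- The polynomial bounding the link of a last vertex `v ≥ 7`: `a, …, e` are the weights of
`0, …, 4`, and `m` is the total weight of the other vertices below `v`.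
The left side, with `m` as large as possible, is nondecreasing in each variable on `[0, 1/6]`, where
it is thus largest at the upper end point. -/
lemma link_last_le {a b c d e m : ℝ} (ha : 0 ≤ a) (hb : 0 ≤ b) (hc : 0 ≤ c) (hd : 0 ≤ d)
    (he : 0 ≤ e) (ha' : a ≤ 1 / 6) (hb' : b ≤ 1 / 6) (hc' : c ≤ 1 / 6) (hd' : d ≤ 1 / 6)
    (he' : e ≤ 1 / 6) (hm : a + b + c + d + e + m ≤ 1) :
    a * (b * c + b * d + b * e + c * d + c * e + d * e + (b + c + d + e) * m) +
      b * c * (d + e + m) + b * d * e + c * d * e ≤ 5 / 72 := by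
  have hcoef : 0 ≤ a * (b + c + d + e) + b * c := by positivity
  let P : ℝ → ℝ → ℝ → ℝ → ℝ → ℝ := fun a b c d e =>
    a * (b * c + b * d + b * e + c * d + c * e + d * e) + b * c * d + b * c * e + b * d * e +
      c * d * e + (a * (b + c + d + e) + b * c) * (1 - a - b - c - d - e)
  have h0 : a * (b * c + b * d + b * e + c * d + c * e + d * e + (b + c + d + e) * m) +
      b * c * (d + e + m) + b * d * e + c * d * e ≤ P a b c d e := by
    have := mul_le_mul_of_nonneg_left (by linarith : m ≤ 1 - a - b - c - d - e) hcoef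
    simp only [P]
    linarith
  have h1 : P a b c d e ≤ P a b c d (1 / 6) := by
    have := mul_nonneg (sub_nonneg.2 he') (add_nonneg (add_nonneg
      (mul_nonneg ha (by linarith : 0 ≤ 1 - a - b - c - d - e - 1 / 6)) (mul_nonneg hb hd))
      (mul_nonneg hc hd))
    simp only [P]
    linarith
  have h2 : P a b c d (1 / 6) ≤ P a b c (1 / 6) (1 / 6) := by
    have := mul_nonneg (sub_nonneg.2 hd') (add_nonneg
      (mul_nonneg ha (by linarith : 0 ≤ 1 - a - b - c - d - 1 / 6 - 1 / 6)) (add_nonneg hb hc))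
    have := mul_nonneg (sub_nonneg.2 hd')
      (mul_nonneg ha (by linarith : 0 ≤ 1 - a - b - c - d - 1 / 6 - 1 / 6))
    simp only [P]
    linarith
  have h3 : P a b c (1 / 6) (1 / 6) ≤ P a b (1 / 6) (1 / 6) (1 / 6) := by
    have := mul_nonneg (sub_nonneg.2 hc')
      (mul_nonneg (add_nonneg ha hb) (by linarith : 0 ≤ 1 - a - b - c - 1 / 6 - 1 / 6 - 1 / 6))
    have := mul_nonneg (sub_nonneg.2 hc') hb
    simp only [P]
    linarith
  have h4 : P a b (1 / 6) (1 / 6) (1 / 6) ≤ P a (1 / 6) (1 / 6) (1 / 6) (1 / 6) := by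
    have := mul_nonneg (sub_nonneg.2 hb')
      (mul_nonneg ha (by linarith : 0 ≤ 1 - a - b - 1 / 6 - 1 / 6 - 1 / 6 - 1 / 6))
    have := mul_nonneg (sub_nonneg.2 hb') hb
    simp only [P]
    nlinarith
  have h5 : P a (1 / 6) (1 / 6) (1 / 6) (1 / 6) ≤ P (1 / 6) (1 / 6) (1 / 6) (1 / 6) (1 / 6) := by
    simp only [P]
    nlinarith
  have h6 : P (1 / 6) (1 / 6) (1 / 6) (1 / 6) (1 / 6) = 5 / 72 := by
    simp only [P]
    norm_num
  linarith

/-! ### The bound for optimal shifted families -/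

lemma sum_range_eq {x : ℕ → ℝ} {N : ℕ} (hN : 5 ≤ N) :
    ∑ i ∈ range N, x i = x 0 + x 1 + x 2 + x 3 + x 4 + ∑ i ∈ Ico 5 N, x i := by
  rw [range_eq_Ico, sum_eq_sum_Ico_succ_bot (by omega), sum_eq_sum_Ico_succ_bot (by omega),
    sum_eq_sum_Ico_succ_bot (by omega), sum_eq_sum_Ico_succ_bot (by omega),
    sum_eq_sum_Ico_succ_bot (by omega)]
  ring

lemma weight_sdiff {x : ℕ → ℝ} {L L' : Finset (Finset ℕ)} (h : L' ⊆ L) :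
    weight x (L \ L') = weight x L - weight x L' := by
  unfold weight
  rw [← sum_sdiff h]
  ring

lemma esum_Ico_one_two (x : ℕ → ℝ) {b : ℕ} (hb : 5 ≤ b) :
    esum x 2 (Ico 1 b) = esum x 2 (Ico 5 b) + (x 1 + x 2 + x 3 + x 4) * ∑ i ∈ Ico 5 b, x i +
      (x 1 * x 2 + x 1 * x 3 + x 1 * x 4 + x 2 * x 3 + x 2 * x 4 + x 3 * x 4) := by
  have h1 (a : ℕ) (h : a < b) := esum_Ico x 1 h
  have h0 (a : ℕ) (h : a < b) := sum_eq_sum_Ico_succ_bot h x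
  simp only [esum_one] at h1
  rw [h1 1 (by omega), h1 2 (by omega), h1 3 (by omega), h1 4 (by omega), h0 2 (by omega),
    h0 3 (by omega), h0 4 (by omega)]
  ring

lemma esum_Ico_one_three (x : ℕ → ℝ) {b : ℕ} (hb : 5 ≤ b) :
    esum x 3 (Ico 1 b) = esum x 3 (Ico 5 b) + (x 1 + x 2 + x 3 + x 4) * esum x 2 (Ico 5 b) +
      (x 1 * x 2 + x 1 * x 3 + x 1 * x 4 + x 2 * x 3 + x 2 * x 4 + x 3 * x 4) *
        ∑ i ∈ Ico 5 b, x i +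
      (x 1 * x 2 * x 3 + x 1 * x 2 * x 4 + x 1 * x 3 * x 4 + x 2 * x 3 * x 4) := by
  have h2 (a : ℕ) (h : a < b) := esum_Ico x 2 h
  have h1 (a : ℕ) (h : a < b) := esum_Ico x 1 h
  have h0 (a : ℕ) (h : a < b) := sum_eq_sum_Ico_succ_bot h x
  simp only [esum_one] at h1
  rw [h2 1 (by omega), h2 2 (by omega), h2 3 (by omega), h2 4 (by omega), h1 2 (by omega),
    h1 3 (by omega), h1 4 (by omega), h0 3 (by omega), h0 4 (by omega)]
  ring

/-- If every member contains `0`, the weight is at most that of the full star at `0`. -/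
lemma weight_le_of_forall_zero_mem {N : ℕ} {H : Finset (Finset ℕ)} {x : ℕ → ℝ}
    (hH : H ∈ families N) (hx : x ∈ weightings N) (h : ∀ e ∈ H, 0 ∈ e) :
    weight x H ≤ 9 / 512 := by
  obtain ⟨h0, hN, h1⟩ := hx
  have hpos : 0 < N := by
    rcases Nat.eq_zero_or_pos N with rfl | hpos
    · simp at h1
    · exact hpos
  have hw : weight x H = x 0 * linkWeight x H 0 := by
    unfold weight linkWeight
    rw [filter_true_of_mem h, mul_sum]
    exact sum_congr rfl fun e he => (mul_prod_erase e x (h e he)).symm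
  have hl : linkWeight x H 0 ≤ esum x 3 (Ico 1 N) := by
    refine linkWeight_le h0 fun e he h0e _ => ?_
    have hc := mem_powersetCard.1 (hH.1 he)
    refine mem_powersetCard.2 ⟨fun i hi => ?_, by rw [card_erase_of_mem h0e, hc.2]⟩
    have := mem_range.1 (hc.1 (mem_of_mem_erase hi))
    have := ne_of_mem_erase hi
    exact mem_Ico.2 ⟨by omega, by omega⟩
  have hs : ∑ i ∈ Ico 1 N, x i = 1 - x 0 := by
    rw [← h1, range_eq_Ico, sum_eq_sum_Ico_succ_bot hpos]
    ring
  have h6 := six_mul_esum_three_le h0 (Ico 1 N)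
  rw [hs] at h6
  have := mul_le_mul_of_nonneg_left hl (h0 0)
  have := mul_le_mul_of_nonneg_left h6 (h0 0)
  have := mul_one_sub_pow_three_le (x 0)
  linarith

/-- If some member avoids the heaviest vertex `0`, then the members containing `0` meet
`{1, 2, 3, 4}`, which makes the link of `0` light once `x 0 ≥ 1/6`. -/
lemma linkWeight_zero_le {N : ℕ} (hN : 5 ≤ N) {H : Finset (Finset ℕ)} {x : ℕ → ℝ}
    (hH : H ∈ families N) (hx : x ∈ weightings N) (h : ({1, 2, 3, 4} : Finset ℕ) ∈ H)
    (hx0 : 1 / 6 ≤ x 0) : linkWeight x H 0 ≤ 9 / 128 := by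
  obtain ⟨h0, -, h1⟩ := hx
  have hsub : powersetCard 3 (Ico 5 N) ⊆ powersetCard 3 (Ico 1 N) :=
    powersetCard_mono (Ico_subset_Ico (by omega) le_rfl)
  have hl : linkWeight x H 0 ≤ weight x (powersetCard 3 (Ico 1 N) \ powersetCard 3 (Ico 5 N)) := by
    refine linkWeight_le h0 fun e he h0e _ => ?_
    have hc := mem_powersetCard.1 (hH.1 he)
    refine mem_sdiff.2 ⟨mem_powersetCard.2 ⟨fun i hi => ?_, by rw [card_erase_of_mem h0e, hc.2]⟩,
      fun h5 => ?_⟩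
    · have := mem_range.1 (hc.1 (mem_of_mem_erase hi))
      have := ne_of_mem_erase hi
      exact mem_Ico.2 ⟨by omega, by omega⟩
    · obtain ⟨i, hi, hi'⟩ := not_disjoint_iff.1 (hH.2 (mem_coe.2 he) (mem_coe.2 h))
      simp only [mem_insert, mem_singleton] at hi'
      have := mem_Ico.1 ((mem_powersetCard.1 h5).1 (mem_erase.2 ⟨by omega, hi⟩))
      omega
  rw [weight_sdiff hsub] at hl
  change _ ≤ esum x 3 (Ico 1 N) - esum x 3 (Ico 5 N) at hl
  rw [esum_Ico_one_three x hN] at hl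
  rw [sum_range_eq hN] at h1
  have hm : 0 ≤ ∑ i ∈ Ico 5 N, x i := sum_nonneg fun i _ => h0 i
  have hf : 0 ≤ x 1 + x 2 + x 3 + x 4 := by linarith [h0 1, h0 2, h0 3, h0 4]
  have := cubic_meeting_le hf hm (by linarith)
  have := mul_le_mul_of_nonneg_left (two_mul_esum_two_le x (Ico 5 N)) hf
  have := mul_le_mul_of_nonneg_right (esymm_two_four_le (x 1) (x 2) (x 3) (x 4)) hm
  have := esymm_three_four_le (h0 1) (h0 2) (h0 3) (h0 4)
  linarith

/-- If only seven vertices carry weight, then `x 0 ≥ 1/7`, and the triples from the other six weigh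
at most as much as for equal weights, `20 / 343`. -/
lemma linkWeight_zero_le_of_seven {N : ℕ} (hN : 7 ≤ N) {H : Finset (Finset ℕ)} {x : ℕ → ℝ}
    (hH : H ∈ families N) (hx : x ∈ weightings N) (hanti : Antitone x)
    (h7 : ∀ i, 7 ≤ i → x i = 0) : linkWeight x H 0 ≤ 9 / 128 := by
  obtain ⟨h0, -, h1⟩ := hx
  have hl : linkWeight x H 0 ≤ esum x 3 (Ico 1 7) := by
    refine linkWeight_le h0 fun e he h0e hpos => ?_
    have hc := mem_powersetCard.1 (hH.1 he)
    refine mem_powersetCard.2 ⟨fun i hi => ?_, by rw [card_erase_of_mem h0e, hc.2]⟩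
    have := ne_of_mem_erase hi
    have : ¬ 7 ≤ i := fun hle => (hpos i hi).ne' (h7 i hle)
    exact mem_Ico.2 ⟨by omega, by omega⟩
  have hs : ∑ i ∈ range 7, x i = 1 := by
    rw [← h1]
    exact sum_subset (range_mono hN) fun i _ hi => h7 i (by simpa using hi)
  rw [esum_Ico_one_three x (by norm_num)] at hl
  have hI : Ico 5 7 = {5, 6} := rfl
  have e3 : esum x 3 (Ico 5 7) = 0 := by
    rw [esum, powersetCard_eq_empty.2 (by simp)]
    rfl
  have e2 : esum x 2 (Ico 5 7) = x 5 * x 6 := by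
    rw [esum, hI, show ({5, 6} : Finset ℕ).powersetCard 2 = {{5, 6}} from rfl]
    simp [weight]
  have e1 : ∑ i ∈ Ico 5 7, x i = x 5 + x 6 := by
    rw [hI]
    simp
  rw [sum_range_eq (by norm_num), e1] at hs
  rw [e1, e2, e3] at hl
  have hm : 0 ≤ x 5 + x 6 := by linarith [h0 5, h0 6]
  have hf : 0 ≤ x 1 + x 2 + x 3 + x 4 := by linarith [h0 1, h0 2, h0 3, h0 4]
  have hx0 : 1 / 7 ≤ x 0 := by
    linarith [hanti (Nat.zero_le 1), hanti (Nat.zero_le 2), hanti (Nat.zero_le 3),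
      hanti (Nat.zero_le 4), hanti (Nat.zero_le 5), hanti (Nat.zero_le 6)]
  have := cubic_six_vertices_le hf hm (by linarith)
  have := mul_le_mul_of_nonneg_left (show x 5 * x 6 ≤ (x 5 + x 6) ^ 2 / 4 by
    nlinarith [sq_nonneg (x 5 - x 6)]) hf
  have := mul_le_mul_of_nonneg_right (esymm_two_four_le (x 1) (x 2) (x 3) (x 4)) hm
  have := esymm_three_four_le (h0 1) (h0 2) (h0 3) (h0 4)
  linarith

/-- In a shifted intersecting family, the members whose largest element `v` is at least `7` have
few possible shapes: `{1, 3, 5, 7}` is not a member, as `{0, 2, 4, 6}` would then be one too. -/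
lemma link_last_shapes {N : ℕ} {H : Finset (Finset ℕ)} (hH : H ∈ families N) (hsh : IsShifted H)
    (h : ({1, 2, 3, 4} : Finset ℕ) ∈ H) {p q r v : ℕ} (hpq : p < q) (hqr : q < r) (hrv : r < v)
    (hv : 7 ≤ v) (he : ({p, q, r, v} : Finset ℕ) ∈ H) :
    p = 0 ∧ q ≤ 4 ∨ p = 1 ∧ q = 2 ∨ q = 3 ∧ r = 4 := by
  rcases Nat.eq_zero_or_pos p with rfl | hp
  · left
    refine ⟨rfl, ?_⟩
    obtain ⟨i, hi, hi'⟩ := not_disjoint_iff.1 (hH.2 (mem_coe.2 he) (mem_coe.2 h))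
    simp only [mem_insert, mem_singleton] at hi hi'
    omega
  · by_contra! hne
    have h1 := hsh.mem_of_le he hpq hqr hrv (p' := 1) (q' := 3) (r' := 5) (s' := 7) (by norm_num)
      (by norm_num) (by norm_num) hp (by omega) (by omega) hv
    have h2 := hsh.mem_of_le h1 (p' := 0) (q' := 2) (r' := 4) (s' := 6) (by norm_num) (by norm_num)
      (by norm_num) (by norm_num) (by norm_num) (by norm_num) (by norm_num) (by norm_num)
      (by norm_num) (by norm_num)
    exact hH.2 (mem_coe.2 h1) (mem_coe.2 h2) (by decide)

/-- The link of the last vertex of positive weight consists, up to sets of weight zero, of triples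
`{0, q, r}` with `q ≤ 4`, triples `{1, 2, r}`, and `{1, 3, 4}`, `{2, 3, 4}`. -/
lemma linkWeight_last_le {N : ℕ} {H : Finset (Finset ℕ)} {x : ℕ → ℝ}
    (hH : H ∈ families N) (hsh : IsShifted H) (hx : x ∈ weightings N) (hanti : Antitone x)
    (h : ({1, 2, 3, 4} : Finset ℕ) ∈ H) {v : ℕ} (hv : 7 ≤ v) (hvN : v < N)
    (hlast : ∀ i, v < i → x i = 0) (hx0 : x 0 ≤ 1 / 6) : linkWeight x H v ≤ 5 / 72 := by
  obtain ⟨h0, -, h1⟩ := hx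
  have hsub : powersetCard 2 (Ico 5 v) ⊆ powersetCard 2 (Ico 1 v) :=
    powersetCard_mono (Ico_subset_Ico (by omega) le_rfl)
  set A : Finset (Finset ℕ) := powersetCard 2 (Ico 1 v) \ powersetCard 2 (Ico 5 v)
  have hl : linkWeight x H v ≤ weight x (A.image (insert 0) ∪
      ((Ico 3 v).image (fun r => {1, 2, r}) ∪ {{1, 3, 4}, {2, 3, 4}})) := by
    refine linkWeight_le h0 fun e he hve hpos => ?_
    obtain ⟨p, q, r, s, hpq, hqr, hrs, rfl⟩ :=
      exists_eq_of_card_eq_four (mem_powersetCard.1 (hH.1 he)).2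
    -- the largest element is `v`, since later vertices have weight zero
    have hs : s = v := by
      by_contra hne
      have h2 : ¬ v < s := fun hlt => (hpos s (mem_erase.2 ⟨hne, by simp⟩)).ne' (hlast s hlt)
      simp only [mem_insert, mem_singleton] at hve
      omega
    subst hs
    have hT : ({p, q, r, s} : Finset ℕ).erase s = {p, q, r} := by
      ext k
      simp only [mem_erase, mem_insert, mem_singleton]
      omega
    rw [hT]
    rcases link_last_shapes hH hsh h hpq hqr hrs hv he with ⟨rfl, hq⟩ | ⟨rfl, rfl⟩ | ⟨rfl, rfl⟩
    · refine mem_union_left _ (mem_image.2 ⟨{q, r}, mem_sdiff.2 ⟨mem_powersetCard.2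
        ⟨fun k hk => ?_, card_pair hqr.ne⟩, fun h5 => ?_⟩, rfl⟩)
      · simp only [mem_insert, mem_singleton] at hk
        exact mem_Ico.2 ⟨by omega, by omega⟩
      · have := mem_Ico.1 ((mem_powersetCard.1 h5).1 (mem_insert_self q _))
        omega
    · exact mem_union_right _ (mem_union_left _ (mem_image.2 ⟨r, mem_Ico.2 ⟨hqr, hrs⟩, rfl⟩))
    · have : p = 0 ∨ p = 1 ∨ p = 2 := by omega
      rcases this with rfl | rfl | rfl
      · refine mem_union_left _ (mem_image.2 ⟨{3, 4}, mem_sdiff.2 ⟨mem_powersetCard.2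
          ⟨fun k hk => ?_, card_pair hqr.ne⟩, fun h5 => ?_⟩, rfl⟩)
        · simp only [mem_insert, mem_singleton] at hk
          exact mem_Ico.2 ⟨by omega, by omega⟩
        · have := mem_Ico.1 ((mem_powersetCard.1 h5).1 (mem_insert_self 3 _))
          omega
      · exact mem_union_right _ (mem_union_right _ (by simp))
      · exact mem_union_right _ (mem_union_right _ (by simp))
  have hI : weight x (A.image (insert 0)) ≤ x 0 * (esum x 2 (Ico 1 v) - esum x 2 (Ico 5 v)) := by
    refine (weight_image_le h0 _ _).trans_eq ?_
    unfold esum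
    rw [← weight_sdiff hsub, weight, mul_sum]
    refine sum_congr rfl fun T hT => prod_insert fun h0T => ?_
    have := mem_Ico.1 ((mem_powersetCard.1 (mem_sdiff.1 hT).1).1 h0T)
    omega
  have hJ : weight x ((Ico 3 v).image (fun r => {1, 2, r})) ≤
      x 1 * x 2 * (x 3 + x 4 + ∑ i ∈ Ico 5 v, x i) := by
    refine (weight_image_le h0 _ _).trans_eq ?_
    have h3 : ∑ i ∈ Ico 3 v, x i = x 3 + x 4 + ∑ i ∈ Ico 5 v, x i := by
      rw [sum_eq_sum_Ico_succ_bot (by omega), sum_eq_sum_Ico_succ_bot (by omega)]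
      ring
    rw [← h3, mul_sum]
    refine sum_congr rfl fun r hr => ?_
    have := mem_Ico.1 hr
    rw [prod_insert (by simp; omega), prod_insert (by simp; omega), prod_singleton]
    ring
  have hK : weight x {{1, 3, 4}, {2, 3, 4}} = x 1 * x 3 * x 4 + x 2 * x 3 * x 4 := by
    rw [weight, sum_pair (by decide)]
    simp [mul_assoc]
  have hs : ∑ i ∈ range v, x i ≤ 1 := by
    rw [← h1]
    exact sum_le_sum_of_subset_of_nonneg (range_mono hvN.le) fun i _ _ => h0 i
  rw [sum_range_eq (by omega)] at hs
  rw [esum_Ico_one_two x (by omega)] at hI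
  have hle (i : ℕ) : x i ≤ 1 / 6 := (hanti (Nat.zero_le i)).trans hx0
  have hP := link_last_le (h0 0) (h0 1) (h0 2) (h0 3) (h0 4) (hle 0) (hle 1) (hle 2) (hle 3)
    (hle 4) hs
  have hU := weight_union_le h0 (A.image (insert 0))
    ((Ico 3 v).image (fun r => {1, 2, r}) ∪ {{1, 3, 4}, {2, 3, 4}})
  have hV := weight_union_le h0 ((Ico 3 v).image (fun r => {1, 2, r})) {{1, 3, 4}, {2, 3, 4}}
  rw [hK] at hV
  linarith

/-- An intersecting family of `4`-sets has weight at most `9/512` for every weighting. -/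
theorem weight_le {N : ℕ} (hN : 7 ≤ N) {H : Finset (Finset ℕ)} {x : ℕ → ℝ} (hH : H ∈ families N)
    (hx : x ∈ weightings N) : weight x H ≤ 9 / 512 := by
  obtain ⟨K, y, hopt, hanti, hsh⟩ := exists_isOptimal_isShifted (show 0 < N by omega)
  refine (hopt.2.2 H hH x hx).trans ?_
  have hK := hopt.1
  have hy := hopt.2.1
  by_cases hstar : ∀ e ∈ K, 0 ∈ e
  · exact weight_le_of_forall_zero_mem hK hy hstar
  push Not at hstar
  obtain ⟨e, he, h0e⟩ := hstar
  obtain ⟨p, q, r, s, hpq, hqr, hrs, rfl⟩ :=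
    exists_eq_of_card_eq_four (mem_powersetCard.1 (hK.1 he)).2
  have hp : p ≠ 0 := fun h => h0e (by simp [h])
  have h1234 : ({1, 2, 3, 4} : Finset ℕ) ∈ K :=
    hsh.mem_of_le he hpq hqr hrs (by norm_num) (by norm_num) (by norm_num) (by omega) (by omega)
      (by omega) (by omega)
  have hpos : ∃ i ∈ range N, y i ≠ 0 := exists_ne_zero_of_sum_ne_zero (by
    rw [hy.2.2]
    exact one_ne_zero)
  obtain ⟨i, -, hi⟩ := hpos
  have hy0 : 0 < y 0 := ((hy.1 i).lt_of_ne' hi).trans_le (hanti (Nat.zero_le i))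
  rcases le_or_gt (1 / 6) (y 0) with hbig | hsmall
  · linarith [hopt.four_mul_weight_le hy0, linkWeight_zero_le (by omega) hK hy h1234 hbig]
  · set v := Nat.findGreatest (fun i => y i ≠ 0) N with hv
    have hv0 : y v ≠ 0 := Nat.findGreatest_spec (P := fun i => y i ≠ 0) (Nat.zero_le N) hy0.ne'
    have hlast : ∀ i, v < i → y i = 0 := fun i hi => by
      by_contra hne
      by_cases hiN : i ≤ N
      · exact Nat.findGreatest_is_greatest hi hiN hne
      · exact hne (hy.2.1 i (by omega))
    have hvN : v < N := by
      by_contra hlt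
      exact hv0 (hy.2.1 v (not_lt.1 hlt))
    rcases le_or_gt 7 v with h7 | h7
    · linarith [hopt.four_mul_weight_le ((hy.1 v).lt_of_ne' hv0),
        linkWeight_last_le hK hsh hy hanti h1234 h7 hvN hlast hsmall.le]
    · linarith [hopt.four_mul_weight_le hy0,
        linkWeight_zero_le_of_seven hN hK hy hanti fun i hi => hlast i (by omega)]

end IntersectingFamily

namespace RGraph

open Finset Filter Topology

/-! ### Two disjoint edges, and the density bound -/

lemma not_disjoint_of_free_matching {V : Type*} {G : RGraph 4 V} (hG : Free (matching 4 2) G)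
    {a b : Finset V} (ha : a ∈ G.edges) (hb : b ∈ G.edges) : ¬ Disjoint a b := by
  intro hab
  let α := (a.equivFinOfCardEq (G.uniform a ha)).symm
  let β := (b.equivFinOfCardEq (G.uniform b hb)).symm
  let g : Fin 2 × Fin 4 → V := fun z => if z.1 = 0 then α z.2 else β z.2
  have hne (i j : Fin 4) : (α i : V) ≠ β j := fun h =>
    disjoint_left.1 hab (α i).2 (h ▸ (β j).2)
  have hg : Function.Injective g := by
    rintro ⟨i, i'⟩ ⟨j, j'⟩ h
    have hi : i = 0 ∨ i = 1 := by omega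
    have hj : j = 0 ∨ j = 1 := by omega
    rcases hi with rfl | rfl <;> rcases hj with rfl | rfl
    · simpa [g, Subtype.val_inj] using h
    · exact absurd h (hne _ _)
    · exact absurd h.symm (hne _ _)
    · simpa [g, Subtype.val_inj] using h
  refine hG ⟨⟨g, hg⟩, fun e he => ?_⟩
  obtain ⟨i, -, rfl⟩ := mem_image.1 he
  have hi : i = 0 ∨ i = 1 := by omega
  rcases hi with rfl | rfl
  · convert ha
    refine eq_of_subset_of_card_le (fun v hv => ?_) (by simp [G.uniform a ha])
    obtain ⟨⟨i, j⟩, hz, rfl⟩ := mem_map.1 hv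
    obtain rfl : 0 = i := by simpa using hz
    exact (α j).2
  · convert hb
    refine eq_of_subset_of_card_le (fun v hv => ?_) (by simp [G.uniform b hb])
    obtain ⟨⟨i, j⟩, hz, rfl⟩ := mem_map.1 hv
    obtain rfl : 1 = i := by simpa using hz
    exact (β j).2

lemma lagrangianFun_le_of_free {n : ℕ} {G : RGraph 4 (Fin n)} (hG : Free (matching 4 2) G)
    {x : Fin n → ℝ} (hx : x ∈ stdSimplex ℝ (Fin n)) : G.lagrangianFun x ≤ 9 / 512 := by
  let y : ℕ → ℝ := fun i => if h : i < n then x ⟨i, h⟩ else 0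
  have hyx (i : Fin n) : y i = x i := by simp [y]
  have hy0 (i : ℕ) (hi : n ≤ i) : y i = 0 := by simp [y, not_lt.2 hi]
  let H := G.edges.map (mapEmbedding Fin.valEmbedding).toEmbedding
  have hw : IntersectingFamily.weight y H = G.lagrangianFun x := by
    simp [IntersectingFamily.weight, H, lagrangianFun, mapEmbedding_apply, hyx]
  rw [← hw]
  refine IntersectingFamily.weight_le (N := n + 7) (by omega)
    ⟨fun e he => ?_, fun a ha b hb => ?_⟩ ⟨fun i => ?_, fun i hi => hy0 i (by omega), ?_⟩
  · obtain ⟨e, he', rfl⟩ := mem_map.1 he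
    refine mem_powersetCard.2 ⟨fun i hi => ?_, by simp [mapEmbedding_apply, G.uniform e he']⟩
    obtain ⟨i, -, rfl⟩ := mem_map.1 (show i ∈ e.map Fin.valEmbedding from hi)
    have := i.2
    simp only [Fin.valEmbedding_apply, mem_range]
    omega
  · obtain ⟨a, ha', rfl⟩ := mem_map.1 (mem_coe.1 ha)
    obtain ⟨b, hb', rfl⟩ := mem_map.1 (mem_coe.1 hb)
    simpa [mapEmbedding_apply] using not_disjoint_of_free_matching hG ha' hb'
  · by_cases h : i < n
    · simpa [y, h] using hx.1 ⟨i, h⟩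
    · rw [hy0 i (not_lt.1 h)]
  · rw [← sum_subset (range_mono (Nat.le_add_right n 7)) fun i _ hi => hy0 i (by simpa using hi),
      ← Fin.sum_univ_eq_sum_range, ← hx.2]
    exact sum_congr rfl fun i _ => hyx i

lemma lagrangian_le_of_free {n : ℕ} (hn : 1 ≤ n) {G : RGraph 4 (Fin n)}
    (hG : Free (matching 4 2) G) : G.lagrangian ≤ 9 / 512 := by
  have : Nonempty (Fin n) := ⟨⟨0, hn⟩⟩
  obtain ⟨x, hx, h⟩ := G.isGreatest_lagrangian.1
  rw [← h]
  exact lagrangianFun_le_of_free hG hx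

/-! ### Stars -/

lemma free_matching_star (n : ℕ) : Free (matching 4 2) (star 4 (0 : Fin (n + 1))) := by
  rintro ⟨f, hf⟩
  have key (i : Fin 2) : ∃ j, f (i, j) = 0 := by
    have h := (mem_filter.1 (hf _ (mem_image.2 ⟨i, mem_univ i, rfl⟩))).2
    obtain ⟨⟨i', j⟩, hz, h0⟩ := mem_map.1 h
    obtain rfl : i = i' := by simpa using hz
    exact ⟨j, h0⟩
  obtain ⟨j, hj⟩ := key 0
  obtain ⟨k, hk⟩ := key 1
  have := f.injective (hj.trans hk.symm)
  simp at this

/-- Weight `1/4` on the centre of the star, the rest being spread evenly over the `n` leaves. -/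
lemma le_lagrangian_star {n : ℕ} (hn : 0 < n) :
    (n.choose 3 : ℝ) * (1 / 4 * (3 / (4 * n)) ^ 3) ≤ (star 4 (0 : Fin (n + 1))).lagrangian := by
  let x : Fin (n + 1) → ℝ := Fin.cons (1 / 4) fun _ => 3 / (4 * n)
  have hx : x ∈ stdSimplex ℝ (Fin (n + 1)) := by
    refine ⟨fun i => ?_, ?_⟩
    · refine Fin.cases ?_ (fun j => ?_) i
      · norm_num [x]
      · simp only [x, Fin.cons_succ]
        positivity
    · simp only [Fin.sum_univ_succ, x, Fin.cons_zero, Fin.cons_succ, sum_const, card_univ,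
        Fintype.card_fin, nsmul_eq_mul]
      field_simp
      norm_num
  refine le_trans (le_of_eq ?_) ((star 4 (0 : Fin (n + 1))).isGreatest_lagrangian.2 ⟨x, hx, rfl⟩)
  have hedges : (star 4 (0 : Fin (n + 1))).edges =
      (powersetCard 3 (univ.erase (0 : Fin (n + 1)))).image (insert 0) := by
    ext e
    simp only [star, mem_filter, mem_powersetCard, mem_image]
    constructor
    · rintro ⟨⟨-, h4⟩, h0⟩
      exact ⟨e.erase 0, ⟨erase_subset_erase _ (subset_univ _), by rw [card_erase_of_mem h0, h4]⟩,
        insert_erase h0⟩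
    · rintro ⟨T, ⟨hT, h3⟩, rfl⟩
      have h0 : (0 : Fin (n + 1)) ∉ T := fun h => (mem_erase.1 (hT h)).1 rfl
      exact ⟨⟨subset_univ _, by rw [card_insert_of_notMem h0, h3]⟩, mem_insert_self _ _⟩
  have hT0 {T : Finset (Fin (n + 1))} (hT : T ∈ powersetCard 3 (univ.erase (0 : Fin (n + 1)))) :
      (0 : Fin (n + 1)) ∉ T := fun h => (mem_erase.1 ((mem_powersetCard.1 hT).1 h)).1 rfl
  rw [lagrangianFun, hedges, sum_image]
  · have hprod : ∀ T ∈ powersetCard 3 (univ.erase (0 : Fin (n + 1))),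
        ∏ i ∈ insert 0 T, x i = 1 / 4 * (3 / (4 * n)) ^ 3 := by
      intro T hT
      have hleaf : ∀ i ∈ T, x i = 3 / (4 * n) := by
        intro i hi
        obtain ⟨j, rfl⟩ := Fin.exists_succ_eq.2 (ne_of_mem_of_not_mem hi (hT0 hT))
        rfl
      rw [prod_insert (hT0 hT), prod_congr rfl hleaf, prod_const, (mem_powersetCard.1 hT).2]
      rfl
    rw [sum_congr rfl hprod, sum_const, card_powersetCard, card_erase_of_mem (mem_univ _),
      nsmul_eq_mul]
    simp
  · intro S hS T hT h
    rw [← erase_insert (hT0 (mem_coe.1 hS)), ← erase_insert (hT0 (mem_coe.1 hT))]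
    exact congrArg (fun s => s.erase 0) h

lemma tendsto_choose_three_mul :
    Tendsto (fun n : ℕ => (n.choose 3 : ℝ) * (1 / 4 * (3 / (4 * n)) ^ 3)) atTop
      (𝓝 (9 / 512)) := by
  have h : Tendsto (fun n : ℕ => 9 / 512 * ((1 - (n : ℝ)⁻¹) * (1 - 2 * (n : ℝ)⁻¹))) atTop
      (𝓝 (9 / 512 * ((1 - 0) * (1 - 2 * 0)))) := by
    have h0 : Tendsto (fun n : ℕ => (n : ℝ)⁻¹) atTop (𝓝 0) := tendsto_inv_atTop_nhds_zero_nat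
    exact ((h0.const_sub 1).mul ((h0.const_mul 2).const_sub 1)).const_mul _
  norm_num at h
  refine h.congr' ?_
  filter_upwards [eventually_ge_atTop 3] with n hn
  obtain ⟨k, rfl⟩ := Nat.exists_eq_add_of_le hn
  have hc : ((3 + k).choose 3 : ℝ) = (3 + k) * (2 + k) * (1 + k) / 6 := by
    have := Nat.add_one_mul_choose_eq (2 + k) 2
    have h2 := Nat.add_one_mul_choose_eq (1 + k) 1
    rw [Nat.choose_one_right] at h2
    have e1 : (2 + k + 1 : ℝ) * (2 + k).choose 2 = (3 + k).choose 3 * 3 := by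
      rw [show 3 + k = 2 + k + 1 by ring]
      exact_mod_cast this
    have e2 : (1 + k + 1 : ℝ) * (1 + k) = (2 + k).choose 2 * 2 := by
      rw [show 2 + k = 1 + k + 1 by ring]
      exact_mod_cast h2
    linear_combination -e1 / 3 - (3 + k) / 6 * e2
  rw [hc]
  have : (3 + k : ℝ) ≠ 0 := by positivity
  push_cast
  field_simp
  ring

lemma tendsto_lagrangian_star :
    Tendsto (fun n : ℕ => (star 4 (0 : Fin (n + 1))).lagrangian) atTop (𝓝 (9 / 512)) := by
  refine tendsto_of_tendsto_of_tendsto_of_le_of_le' tendsto_choose_three_mul tendsto_const_nhds ?_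
    (Eventually.of_forall fun n => lagrangian_le_of_free (by omega) (free_matching_star n))
  filter_upwards [eventually_gt_atTop 0] with n hn
  exact le_lagrangian_star hn

lemma lagrangianDensity_matching : lagrangianDensity (matching 4 2) = (4 ! : ℝ) * (9 / 512) := by
  have hub : ∀ y ∈ {y : ℝ | ∃ n : ℕ, 1 ≤ n ∧ ∃ G : RGraph 4 (Fin n), Free (matching 4 2) G ∧
      y = (4 ! : ℝ) * G.lagrangian}, y ≤ (4 ! : ℝ) * (9 / 512) := by
    rintro y ⟨n, hn, G, hG, rfl⟩
    exact mul_le_mul_of_nonneg_left (lagrangian_le_of_free hn hG) (by positivity)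
  have hmem (n : ℕ) : (4 ! : ℝ) * (star 4 (0 : Fin (n + 1))).lagrangian ∈
      {y : ℝ | ∃ n : ℕ, 1 ≤ n ∧ ∃ G : RGraph 4 (Fin n), Free (matching 4 2) G ∧
      y = (4 ! : ℝ) * G.lagrangian} := ⟨n + 1, by omega, _, free_matching_star n, rfl⟩
  exact le_antisymm (csSup_le ⟨_, hmem 0⟩ hub)
    (le_of_tendsto (tendsto_lagrangian_star.const_mul _)
      (Eventually.of_forall fun n => le_csSup ⟨_, hub⟩ (hmem n)))

end RGraph

theorem corollary1p4 :
    ∃ lamS : ℝ,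
      Filter.Tendsto (fun n : ℕ => (RGraph.star 4 (0 : Fin (n + 1))).lagrangian)
        Filter.atTop (nhds lamS) ∧
      RGraph.lagrangianDensity (RGraph.matching 4 2) = (4 ! : ℝ) * lamS ∧
      (4 ! : ℝ) * lamS = 27 / 64 ∧
      ∀ n : ℕ, RGraph.Free (RGraph.matching 4 2) (RGraph.star 4 (0 : Fin (n + 1))) :=
  ⟨9 / 512, RGraph.tendsto_lagrangian_star, RGraph.lagrangianDensity_matching,
    by norm_num [Nat.factorial], RGraph.free_matching_star⟩
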